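/- Let $G$ be a finite simple graph. For positive integers $k,q$ with $k\ge 2q$, let $G_{k,q}$ be the circular clique: its vertex set is $\{0,1,\dots,k-1\}$, and $ij$ is an edge exactly when $q\le |i-j|\le k-q$. A $(k,q)$-colouring of $G$ is a graph homomorphism $G\to G_{k,q}$. The graph $G$ is $(k,q)$-mixing if it has a $(k,q)$-colouring and the graph whose vertices are the $(k,q)$-colourings of $G$, two of them being adjacent when they differ at exactly one vertex of $G$, is connected. Let $\chi_c(G)=\inf\{k/q : k\ge 2q\ge 2,\ G\to G_{k,q}\}$ be the circular chromatic number, and define the circular mixing threshold $$\mathfrak{M}_c(G)=\inf\{r\in\mathbb{Q} : r\ge\chi_c(G)\text{ and } G \text{ is } (k,q)\text{-mixing for all positive integers } k,q \text{ with } k\ge 2q \text{ and } k/q\ge r\}.$$ Theorem. If $G$ has at least one edge, then the set defining $\mathfrak{M}_c(G)$ is non-empty, and $$\mathfrak{M}_c(G)\le 2\Delta(G),$$ where $\Delta(G)$ is the maximum degree of $G$. -/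

import Mathlib

/-- The circular clique `G_{k,q}`: vertices `0, …, k-1`, with `i j` an edge when
`q ≤ |i - j| ≤ k - q`. (For `q ≥ 1` the clause `i ≠ j` is implied by the others.) -/
def circularClique (k q : ℕ) : SimpleGraph (Fin k) where
  Adj i j := i ≠ j ∧ (q : ℤ) ≤ |((i : ℕ) : ℤ) - ((j : ℕ) : ℤ)| ∧
    |((i : ℕ) : ℤ) - ((j : ℕ) : ℤ)| ≤ (k : ℤ) - (q : ℤ)
  symm := ⟨fun i j h => ⟨h.1.symm, by rw [abs_sub_comm]; exact h.2⟩⟩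
  loopless := ⟨fun _ h => h.1 rfl⟩

/-- The `H`-colour graph of `G`: its vertices are the homomorphisms `G → H`, two of them being
adjacent when they differ at exactly one vertex of `G`. -/
def colourGraph {V W : Type*} (G : SimpleGraph V) (H : SimpleGraph W) : SimpleGraph (G →g H) where
  Adj f g := ∃! v : V, f v ≠ g v
  symm := ⟨fun f g h => by simpa only [ne_comm] using h⟩
  loopless := ⟨fun f h => by obtain ⟨v, hv, -⟩ := h; exact hv rfl⟩

/-- `G` is `(k,q)`-mixing: the `(k,q)`-colour graph of `G` is connected
(in particular there is a `(k,q)`-colouring). -/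
def IsCircularMixing {V : Type*} (G : SimpleGraph V) (k q : ℕ) : Prop :=
  (colourGraph G (circularClique k q)).Connected

/-- The circular chromatic number `χ_c(G) = inf {k/q : G → G_{k,q}}`. -/
noncomputable def circularChromaticNumber {V : Type*} (G : SimpleGraph V) : ℝ :=
  sInf {x : ℝ | ∃ k q : ℕ, 0 < q ∧ 2 * q ≤ k ∧ Nonempty (G →g circularClique k q) ∧
    x = (k : ℝ) / (q : ℝ)}

/-- The rationals `r ≥ χ_c(G)` such that `G` is `(k,q)`-mixing for all `k/q ≥ r`,
as a set of reals. -/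
def circularMixingThresholdSet {V : Type*} (G : SimpleGraph V) : Set ℝ :=
  {x : ℝ | ∃ r : ℚ, x = (r : ℝ) ∧ circularChromaticNumber G ≤ (r : ℝ) ∧
    ∀ k q : ℕ, 0 < q → 2 * q ≤ k → (r : ℝ) ≤ (k : ℝ) / (q : ℝ) → IsCircularMixing G k q}

/-- The circular mixing threshold `𝔐_c(G)`. -/
noncomputable def circularMixingThreshold {V : Type*} (G : SimpleGraph V) : ℝ :=
  sInf (circularMixingThresholdSet G)

/-! Every rational above `2Δ` lies in the defining set, because `k > 2qΔ` forces mixing. The engine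
is a Cauchy–Davenport type estimate on the cycle: nonempty colour sets with no edge between them
have total size at most `2q`. Hence two lists of size above `2q` span a connected bipartite graph of
compatible pairs. Mixing follows by adding vertices one at a time. To recolour a neighbour `v` of
the new vertex `w`, freeze everything else. Each of `v`, `w` ignores the other and has at most `Δ -
1` further neighbours, each forbidding at most `2q - 1` colours, so both lists exceed `2q`. A path
of compatible pairs then moves `v` and `w` alternately. -/

/-! ### Expansion in the circular clique -/

open Finset Fin.NatCast Fin.CommRing in
/-- In `Fin k`, adding the translates of a nonempty set by `0, …, m` gains at least `m` elements,
unless everything is reached. -/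
theorem exists_translates_card {k : ℕ} [NeZero k] (X : Finset (Fin k)) (hX : X.Nonempty) (q m : ℕ) :
    ∃ A : Finset (Fin k), A.Nonempty ∧ min k (X.card + m) ≤ A.card ∧
      ∀ y ∈ A, ∃ x ∈ X, ∃ t : ℕ, q ≤ t ∧ t ≤ q + m ∧ y = x + (t : Fin k) := by
  induction m with
  | zero =>
    refine ⟨X.map (addRightEmbedding (q : Fin k)), hX.map, by simp, ?_⟩
    intro y hy
    obtain ⟨x, hx, rfl⟩ := Finset.mem_map.1 hy
    exact ⟨x, hx, q, le_rfl, le_rfl, rfl⟩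
  | succ m ih =>
    obtain ⟨A, hne, hcard, hA⟩ := ih
    -- A nonempty set closed under `+ 1` is everything; otherwise some `y + 1` is a new element.
    by_cases hcl : ∀ y ∈ A, y + 1 ∈ A
    · obtain ⟨a, ha⟩ := hne
      have hadd : ∀ n : ℕ, a + (n : Fin k) ∈ A := by
        intro n
        induction n with
        | zero => simpa using ha
        | succ n ihn =>
          have := hcl _ ihn
          rwa [add_assoc, ← Nat.cast_succ] at this
      have huniv : A = univ := by
        refine eq_univ_iff_forall.2 fun y => ?_
        have := hadd (y - a).val
        rwa [Fin.cast_val_eq_self, add_sub_cancel] at this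
      refine ⟨A, ⟨a, ha⟩, by simp [huniv], fun y hy => ?_⟩
      obtain ⟨x, hx, t, h1, h2, h3⟩ := hA y hy
      exact ⟨x, hx, t, h1, by omega, h3⟩
    · push Not at hcl
      obtain ⟨y, hy, hy1⟩ := hcl
      refine ⟨insert (y + 1) A, insert_nonempty _ _, ?_, ?_⟩
      · rw [card_insert_of_notMem hy1]
        omega
      · intro z hz
        rcases mem_insert.1 hz with rfl | hz
        · obtain ⟨x, hx, t, h1, h2, rfl⟩ := hA y hy
          exact ⟨x, hx, t + 1, by omega, by omega, by push_cast; rw [add_assoc]⟩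
        · obtain ⟨x, hx, t, h1, h2, h3⟩ := hA z hz
          exact ⟨x, hx, t, h1, by omega, h3⟩

open Fin.NatCast Fin.CommRing in
theorem circularClique_adj_add {k q : ℕ} [NeZero k] (hq : 0 < q) (x : Fin k) {t : ℕ} (h1 : q ≤ t)
    (h2 : t ≤ k - q) : (circularClique k q).Adj x (x + (t : Fin k)) := by
  have htk : t < k := by have := NeZero.pos k; omega
  have hv : (x + (t : Fin k)).val = (x.val + t) % k := by
    rw [Fin.val_add, Fin.val_natCast, Nat.mod_eq_of_lt htk]
  have hx := x.isLt
  have hcase : (x.val + t) % k = x.val + t ∨ (x.val + t) % k + k = x.val + t := by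
    by_cases h : x.val + t < k
    · exact Or.inl (Nat.mod_eq_of_lt h)
    · right
      rw [Nat.mod_eq_sub_mod (by omega), Nat.mod_eq_of_lt (by omega)]
      omega
  have hadj : (q : ℤ) ≤ |((x : ℕ) : ℤ) - (((x + (t : Fin k) : Fin k) : ℕ) : ℤ)| ∧
      |((x : ℕ) : ℤ) - (((x + (t : Fin k) : Fin k) : ℕ) : ℤ)| ≤ (k : ℤ) - (q : ℤ) := by
    rw [hv]
    rcases hcase with h | h
    · rw [abs_of_nonpos (by omega)]
      omega
    · rw [abs_of_nonneg (by omega)]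
      omega
  refine ⟨fun h => ?_, hadj⟩
  rw [← h] at hadj
  simp at hadj
  omega

/-- Two nonempty sets of colours with no edge of `G_{k,q}` between them have at most `2q`
elements altogether. -/
theorem card_add_card_le_of_not_adj {k q : ℕ} (hq : 0 < q) (hk : 2 * q ≤ k)
    {X Y : Finset (Fin k)} (hX : X.Nonempty) (hY : Y.Nonempty)
    (h : ∀ x ∈ X, ∀ y ∈ Y, ¬ (circularClique k q).Adj x y) : X.card + Y.card ≤ 2 * q := by
  have : NeZero k := ⟨by omega⟩
  -- The shifts run over `q, …, k - q`, so `A` consists of neighbours of `X`. As `Y` is nonempty and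
  -- misses `A`, the minimum in `hA` is not `k`.
  obtain ⟨A, -, hA, hAX⟩ := exists_translates_card X hX q (k - 2 * q)
  have hdisj : Disjoint A Y := by
    refine Finset.disjoint_left.2 fun y hyA hyY => ?_
    obtain ⟨x, hx, t, h1, h2, rfl⟩ := hAX y hyA
    exact h x hx _ hyY (circularClique_adj_add hq x h1 (by omega))
  have hle : (A ∪ Y).card ≤ k := by simpa using Finset.card_le_univ (A ∪ Y)
  rw [Finset.card_union_of_disjoint hdisj] at hle
  have := hY.card_pos
  omega

open Classical Finset in
theorem card_filter_not_adj_lt {k q : ℕ} (hq : 0 < q) (hk : 2 * q ≤ k) (x : Fin k) :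
    #{y | ¬ (circularClique k q).Adj y x} ≤ 2 * q - 1 := by
  have hx : x ∈ ({y | ¬ (circularClique k q).Adj y x} : Finset (Fin k)) := by simp
  have := card_add_card_le_of_not_adj (q := q) hq hk (X := {x})
    (Y := ({y | ¬ (circularClique k q).Adj y x} : Finset (Fin k))) (by simp) ⟨x, hx⟩ (by
      intro a ha y hy
      rw [mem_singleton.1 ha, SimpleGraph.adj_comm]
      exact (mem_filter.1 hy).2)
  rw [card_singleton] at this
  omega

/-! ### Colour lists and their compatibility -/

open Classical in
/-- The colours compatible with the colours `f u`, `u ∈ s`. -/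
noncomputable def availableColours {V : Type*} {k : ℕ} (q : ℕ) (f : V → Fin k) (s : Finset V) :
    Finset (Fin k) :=
  {y | ∀ u ∈ s, (circularClique k q).Adj y (f u)}

theorem mem_availableColours {V : Type*} {k q : ℕ} {f : V → Fin k} {s : Finset V} {y : Fin k} :
    y ∈ availableColours q f s ↔ ∀ u ∈ s, (circularClique k q).Adj y (f u) := by
  simp [availableColours]

open Classical Finset in
theorem le_card_availableColours {V : Type*} {k q : ℕ} (hq : 0 < q) (hk : 2 * q ≤ k)
    (f : V → Fin k) (s : Finset V) :
    k ≤ #(availableColours q f s) + #s * (2 * q - 1) := by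
  have hcompl : #{y : Fin k | ¬ ∀ u ∈ s, (circularClique k q).Adj y (f u)} ≤ #s * (2 * q - 1) := by
    refine (card_le_card (t := s.biUnion fun u => {y | ¬ (circularClique k q).Adj y (f u)})
      ?_).trans (card_biUnion_le_card_mul _ _ _ fun u _ => card_filter_not_adj_lt hq hk (f u))
    intro y hy
    simpa using hy
  have := card_filter_add_card_filter_not (s := (univ : Finset (Fin k)))
    (fun y => ∀ u ∈ s, (circularClique k q).Adj y (f u))
  rw [card_univ, Fintype.card_fin] at this
  rw [availableColours]
  omega

open Classical Finset in
/-- If `S` and `T` are large, the compatibility graph between `T` and `S` is connected. -/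
theorem reflTransGen_common_neighbour {k q : ℕ} (hq : 0 < q) (hk : 2 * q ≤ k)
    (S T : Finset (Fin k)) (hS : 2 * q < #S) (hT : 2 * q < #T) {a b : Fin k} (ha : a ∈ T)
    (hb : b ∈ T) :
    Relation.ReflTransGen (fun x x' => x' ∈ T ∧ ∃ y ∈ S, (circularClique k q).Adj x y ∧
      (circularClique k q).Adj x' y) a b := by
  set r : Fin k → Fin k → Prop := fun x x' => x' ∈ T ∧ ∃ y ∈ S, (circularClique k q).Adj x y ∧
      (circularClique k q).Adj x' y
  by_contra hab
  -- This makes both halves of `S` nonempty below, as the cardinality bound requires.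
  have hnb : ∀ x : Fin k, ∃ y ∈ S, (circularClique k q).Adj x y := by
    intro x
    by_contra! hx
    have := card_add_card_le_of_not_adj (q := q) hq hk (X := {x}) (Y := S) (by simp)
      (card_pos.1 (by omega)) (by simpa using hx)
    omega
  set p : Fin k → Prop := fun x => Relation.ReflTransGen r a x
  set p' : Fin k → Prop := fun y => ∃ x ∈ T, p x ∧ (circularClique k q).Adj x y
  obtain ⟨ya, hyaS, hya⟩ := hnb a
  obtain ⟨yb, hybS, hyb⟩ := hnb b
  have hpa : p a := Relation.ReflTransGen.refl
  have key : ∀ x ∈ T, ∀ y ∈ S, p' y → (circularClique k q).Adj x y → p x := by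
    rintro x hx y hy ⟨x', -, hx', hxy'⟩ hxy
    exact hx'.tail ⟨hx, y, hy, hxy', hxy⟩
  -- Reached colours see no unreached ones across the split. The two edge-free pairs give `#S + #T ≤
  -- 4q`, a contradiction.
  have h1 := card_add_card_le_of_not_adj hq hk (X := T.filter p)
    (Y := S.filter fun y => ¬ p' y) ⟨a, mem_filter.2 ⟨ha, hpa⟩⟩
    ⟨yb, mem_filter.2 ⟨hybS, fun h => hab (key b hb yb hybS h hyb)⟩⟩ (by
      intro x hx y hy hxy
      exact (mem_filter.1 hy).2 ⟨x, (mem_filter.1 hx).1, (mem_filter.1 hx).2, hxy⟩)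
  have h2 := card_add_card_le_of_not_adj hq hk (X := T.filter fun x => ¬ p x)
    (Y := S.filter p') ⟨b, mem_filter.2 ⟨hb, hab⟩⟩
    ⟨ya, mem_filter.2 ⟨hyaS, a, ha, hpa, hya⟩⟩ (by
      intro x hx y hy hxy
      exact (mem_filter.1 hx).2
        (key x (mem_filter.1 hx).1 y (mem_filter.1 hy).1 (mem_filter.1 hy).2 hxy))
  have h3 := card_filter_add_card_filter_not (s := T) p
  have h4 := card_filter_add_card_filter_not (s := S) p'
  omega

/-! ### Recolouring on a vertex subset -/

/-- `f` is a homomorphism to `H` on the part of `G` induced by `s`. -/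
def IsHomOn {V W : Type*} (G : SimpleGraph V) (H : SimpleGraph W) (s : Finset V) (f : V → W) :
    Prop :=
  ∀ u ∈ s, ∀ v ∈ s, G.Adj u v → H.Adj (f u) (f v)

/-- One recolouring step between maps that are homomorphisms on `s`. -/
def RecolourStep {V W : Type*} (G : SimpleGraph V) (H : SimpleGraph W) (s : Finset V)
    (f g : V → W) : Prop :=
  IsHomOn G H s g ∧ ∃ v, ∀ u, u ≠ v → g u = f u

open Classical Finset in
theorem IsHomOn.update {V W : Type*} {G : SimpleGraph V} {H : SimpleGraph W} {s : Finset V}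
    {f : V → W} (v : V) (hf : IsHomOn G H (s.erase v) f) {c : W}
    (hc : ∀ u ∈ s, G.Adj v u → H.Adj c (f u)) : IsHomOn G H s (Function.update f v c) := by
  intro u hu u' hu' h
  by_cases h1 : u = v
  · subst h1
    rw [Function.update_self, Function.update_of_ne h.ne']
    exact hc u' hu' h
  · by_cases h2 : u' = v
    · subst h2
      rw [Function.update_self, Function.update_of_ne h1]
      exact (hc u hu h.symm).symm
    · rw [Function.update_of_ne h1, Function.update_of_ne h2]
      exact hf u (mem_erase.2 ⟨h1, hu⟩) u' (mem_erase.2 ⟨h2, hu'⟩) h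

theorem IsHomOn.mono {V W : Type*} {G : SimpleGraph V} {H : SimpleGraph W} {s t : Finset V}
    {f : V → W} (hf : IsHomOn G H t f) (h : s ⊆ t) : IsHomOn G H s f :=
  fun u hu v hv => hf u (h hu) v (h hv)

open Classical Finset in
theorem IsHomOn.recolourStep_update {V W : Type*} {G : SimpleGraph V} {H : SimpleGraph W}
    {s : Finset V} {f : V → W} (hf : IsHomOn G H s f) (v : V) {c : W}
    (hc : ∀ u ∈ s, G.Adj v u → H.Adj c (f u)) :
    RecolourStep G H s f (Function.update f v c) :=
  ⟨(hf.mono (erase_subset _ _)).update v hc, v, fun _ hu => Function.update_of_ne hu _ _⟩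

theorem reachable_of_reflTransGen {V : Type*} [Fintype V] {G : SimpleGraph V} {W : Type*} {H : SimpleGraph W} {f : V → W}
    (hf : IsHomOn G H Finset.univ f) {g : V → W}
    (h : Relation.ReflTransGen (RecolourStep G H Finset.univ) f g)
    (hg : IsHomOn G H Finset.univ g) :
    (colourGraph G H).Reachable ⟨f, fun {u v} => hf u (Finset.mem_univ u) v (Finset.mem_univ v)⟩
      ⟨g, fun {u v} => hg u (Finset.mem_univ u) v (Finset.mem_univ v)⟩ := by
  induction h using Relation.ReflTransGen.head_induction_on with
  | refl => exact .refl _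
  | @head f f' hstep _ ih =>
    refine SimpleGraph.Reachable.trans ?_ (ih hstep.1)
    obtain ⟨hf', v, hv⟩ := hstep
    by_cases hvv : f v = f' v
    · obtain rfl : f = f' := funext fun u => by
        by_cases huv : u = v
        · rw [huv, hvv]
        · exact (hv u huv).symm
      exact .refl _
    · refine SimpleGraph.Adj.reachable ⟨v, hvv, fun u hu => ?_⟩
      by_contra huv
      exact hu (hv u huv).symm

/-! ### Mixing by adding vertices -/

section
variable {V : Type*} [Fintype V] {G : SimpleGraph V} [DecidableRel G.Adj] {k q : ℕ}

open Classical Finset in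
theorem exists_isHomOn (hq : 0 < q) (hΔ : 0 < G.maxDegree) (hk : 2 * q * G.maxDegree < k)
    (s : Finset V) : ∃ f, IsHomOn G (circularClique k q) s f := by
  have hk2 : 2 * q ≤ k := by nlinarith
  induction s using Finset.induction_on with
  | empty => exact ⟨fun _ => ⟨0, by omega⟩, by simp [IsHomOn]⟩
  | insert w s hw ih =>
    obtain ⟨f, hf⟩ := ih
    have h1 := le_card_availableColours hq hk2 f (G.neighborFinset w)
    have h2 : #(G.neighborFinset w) * (2 * q - 1) ≤ G.maxDegree * (2 * q) :=
      Nat.mul_le_mul (G.degree_le_maxDegree w) (by omega)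
    rw [mul_comm G.maxDegree] at h2
    obtain ⟨c, hc⟩ := card_pos.1 
      (show 0 < #(availableColours q f (G.neighborFinset w)) by omega)
    refine ⟨Function.update f w c, IsHomOn.update w (by rwa [erase_insert hw]) ?_⟩
    intro u _ hwu
    exact mem_availableColours.1 hc u (by simpa using hwu)

open Classical Finset in
/-- A vertex with one neighbour disregarded has more than `2q` available colours. -/
theorem two_mul_lt_card_available (hq : 0 < q) (hk : 2 * q * G.maxDegree < k)
    (f : V → Fin k) {v w : V} (hvw : G.Adj v w) :
    2 * q < #(availableColours q f ((G.neighborFinset v).erase w)) := by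
  have hd : 0 < G.degree v := (G.degree_pos_iff_exists_adj v).2 ⟨w, hvw⟩
  have hΔ := G.degree_le_maxDegree v
  have hk2 : 2 * q ≤ k := by nlinarith
  have h1 := le_card_availableColours hq hk2 f ((G.neighborFinset v).erase w)
  rw [card_erase_of_mem (by simpa using hvw), G.card_neighborFinset_eq_degree] at h1
  obtain ⟨d, hd'⟩ : ∃ d, G.maxDegree = d + 1 := ⟨G.maxDegree - 1, by omega⟩
  have h2 : (G.degree v - 1) * (2 * q - 1) ≤ d * (2 * q) :=
    Nat.mul_le_mul (by omega) (by omega)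
  rw [hd'] at hk
  have : 2 * q * (d + 1) = d * (2 * q) + 2 * q := by ring
  omega

open Classical Finset in
/-- A recolouring of a neighbour `v` of `w` can be carried out when `w` is present, at the cost of
recolouring `w`. -/
theorem exists_reflTransGen_recolour_adj (hq : 0 < q) (hk : 2 * q * G.maxDegree < k)
    {s : Finset V} {v w : V} (hw : w ∉ s) (hvw : G.Adj v w) {f : V → Fin k}
    (hf : IsHomOn G (circularClique k q) (insert w s) f) {c : Fin k}
    (hc : IsHomOn G (circularClique k q) s (Function.update f v c)) (hv : v ∈ s) :
    ∃ f', IsHomOn G (circularClique k q) (insert w s) f' ∧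
      Relation.ReflTransGen (RecolourStep G (circularClique k q) (insert w s)) f f' ∧
      f' v = c ∧ ∀ u, u ≠ w → u ≠ v → f' u = f u := by
  have hk2 : 2 * q ≤ k := by
    have hd : 0 < G.degree v := (G.degree_pos_iff_exists_adj v).2 ⟨w, hvw⟩
    have hΔ := G.degree_le_maxDegree v
    nlinarith
  set H := circularClique k q
  set S : Finset (Fin k) := {y | ∀ u ∈ s, u ≠ v → G.Adj w u → H.Adj y (f u)} with hSdef
  set T : Finset (Fin k) := {x | ∀ u ∈ s, G.Adj v u → H.Adj x (f u)} with hTdef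
  have hS : 2 * q < #S := (two_mul_lt_card_available hq hk f hvw.symm).trans_le <| by
    refine card_le_card fun y hy => ?_
    simp only [mem_availableColours, mem_filter, mem_univ, true_and, mem_erase, SimpleGraph.mem_neighborFinset, hSdef]
      at hy ⊢
    exact fun u _ h1 h2 => hy u ⟨h1, h2⟩
  have hT : 2 * q < #T := (two_mul_lt_card_available hq hk f hvw).trans_le <| by
    refine card_le_card fun y hy => ?_
    simp only [mem_availableColours, mem_filter, mem_univ, true_and, mem_erase, SimpleGraph.mem_neighborFinset, hTdef]
      at hy ⊢
    exact fun u hu h2 => hy u ⟨fun h => hw (h ▸ hu), h2⟩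
  have haT : f v ∈ T := mem_filter.2 ⟨mem_univ _, fun u hu h =>
    hf v (mem_insert_of_mem hv) u (mem_insert_of_mem hu) h⟩
  have hcT : c ∈ T := mem_filter.2 ⟨mem_univ _, fun u hu h => by
    have := hc v hv u hu h
    rwa [Function.update_self, Function.update_of_ne h.ne'] at this⟩
  have hchain := reflTransGen_common_neighbour hq hk2 S T hS hT haT hcT
  -- Otherwise the induction would demand these facts of every intermediate colour.
  clear hc hcT
  induction hchain with
  | refl => exact ⟨f, hf, .refl, rfl, fun _ _ _ => rfl⟩
  | @tail x x' _ hstep ih =>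
    obtain ⟨f', hf', hff', hx, heq⟩ := ih
    obtain ⟨hx'T, y, hyS, hxy, hx'y⟩ := hstep
    -- Moving `w` to the common neighbour `y` frees `v` to go from `x` to `x'`.
    have hs1 : RecolourStep G H (insert w s) f' (Function.update f' w y) := by
      refine hf'.recolourStep_update w fun u hu hwu => ?_
      rcases mem_insert.1 hu with rfl | hu
      · exact (G.irrefl hwu).elim
      · by_cases huv : u = v
        · rw [huv, hx]
          exact hxy.symm
        · rw [heq u hwu.ne' huv]
          exact (mem_filter.1 hyS).2 u hu huv hwu
    have hs2 : RecolourStep G H (insert w s) (Function.update f' w y)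
        (Function.update (Function.update f' w y) v x') := by
      refine hs1.1.recolourStep_update v fun u hu hvu => ?_
      by_cases huw : u = w
      · rw [huw, Function.update_self]
        exact hx'y
      · rw [Function.update_of_ne huw, heq u huw hvu.ne']
        exact (mem_filter.1 hx'T).2 u (mem_of_mem_insert_of_ne hu huw) hvu
    refine ⟨_, hs2.1, (hff'.tail hs1).tail hs2, Function.update_self .., fun u h1 h2 => ?_⟩
    rw [Function.update_of_ne h2, Function.update_of_ne h1, heq u h1 h2]

open Classical Finset in
/-- Recolouring sequences lift from `s` to `insert w s`. -/
theorem exists_reflTransGen_lift (hq : 0 < q) (hk : 2 * q * G.maxDegree < k)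
    {s : Finset V} {w : V} (hw : w ∉ s) {f h : V → Fin k}
    (hf : IsHomOn G (circularClique k q) (insert w s) f)
    (hfh : Relation.ReflTransGen (RecolourStep G (circularClique k q) s) f h) :
    ∃ f', IsHomOn G (circularClique k q) (insert w s) f' ∧
      Relation.ReflTransGen (RecolourStep G (circularClique k q) (insert w s)) f f' ∧
      ∀ u, u ≠ w → f' u = h u := by
  induction hfh with
  | refl => exact ⟨f, hf, .refl, fun _ _ => rfl⟩
  | @tail h h' _ hstep ih =>
    obtain ⟨f', hf', hff', heq⟩ := ih
    obtain ⟨hh', v, hv⟩ := hstep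
    by_cases hvw : v = w
    · exact ⟨f', hf', hff', fun u hu => (heq u hu).trans (hv u (hvw ▸ hu)).symm⟩
    have hupd : ∀ u, u ≠ w → Function.update f' v (h' v) u = h' u := by
      intro u hu
      by_cases huv : u = v
      · rw [huv, Function.update_self]
      · rw [Function.update_of_ne huv, heq u hu, hv u huv]
    have hc : IsHomOn G (circularClique k q) s (Function.update f' v (h' v)) := by
      intro u hu u' hu' huu'
      rw [hupd u fun h => hw (h ▸ hu), hupd u' fun h => hw (h ▸ hu')]
      exact hh' u hu u' hu' huu'
    by_cases hadj : v ∈ s ∧ G.Adj v w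
    · obtain ⟨f'', h1, h2, h3, h4⟩ :=
        exists_reflTransGen_recolour_adj hq hk hw hadj.2 hf' hc hadj.1
      refine ⟨f'', h1, hff'.trans h2, fun u hu => ?_⟩
      by_cases huv : u = v
      · rw [huv, h3]
      · rw [h4 u hu huv, heq u hu, hv u huv]
    · refine ⟨Function.update f' v (h' v), ?_, hff'.tail ⟨?_, v, fun u hu =>
        Function.update_of_ne hu _ _⟩, hupd⟩
      all_goals
        by_cases hvs : v ∈ s
        · refine (hf'.mono (erase_subset _ _)).update v fun u hu hvu => ?_
          rcases mem_insert.1 hu with rfl | hu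
          · exact (hadj ⟨hvs, hvu⟩).elim
          · have := hc v hvs u hu hvu
            rwa [Function.update_self, Function.update_of_ne hvu.ne'] at this
        · have hne : ∀ u ∈ insert w s, u ≠ v := by
            rintro u hu rfl
            exact (mem_insert.1 hu).elim hvw hvs
          intro u hu u' hu' huu'
          rw [Function.update_of_ne (hne u hu), Function.update_of_ne (hne u' hu')]
          exact hf' u hu u' hu' huu'

-- Off `s` colours are unconstrained, so `w` may first be given its target colour. The path on `s`
-- then lifts, ending at a map that differs from `g` at most at `w`; one last step repairs `w`.
open Classical Finset in
theorem reflTransGen_recolourStep (hq : 0 < q) (hk : 2 * q * G.maxDegree < k) (s : Finset V)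
    {f g : V → Fin k} (hf : IsHomOn G (circularClique k q) s f)
    (hg : IsHomOn G (circularClique k q) s g) (hfg : ∀ v, v ∉ s → f v = g v) :
    Relation.ReflTransGen (RecolourStep G (circularClique k q) s) f g := by
  induction s using Finset.induction_on generalizing f with
  | empty =>
    obtain rfl : f = g := funext fun v => hfg v (notMem_empty v)
    exact .refl
  | insert w s hw ih =>
    have hfw : IsHomOn G (circularClique k q) s (Function.update f w (g w)) := by
      intro u hu v hv huv
      rw [Function.update_of_ne (ne_of_mem_of_not_mem hu hw),
        Function.update_of_ne (ne_of_mem_of_not_mem hv hw)]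
      exact hf u (mem_insert_of_mem hu) v (mem_insert_of_mem hv) huv
    have hpath := ih hfw (hg.mono (subset_insert _ _)) (by
      intro v hv
      by_cases hvw : v = w
      · rw [hvw, Function.update_self]
      · rw [Function.update_of_ne hvw]
        exact hfg v fun h => hv (mem_of_mem_insert_of_ne h hvw))
    have hstep : RecolourStep G (circularClique k q) s f (Function.update f w (g w)) :=
      ⟨hfw, w, fun _ hu => Function.update_of_ne hu _ _⟩
    obtain ⟨f', -, h2, h3⟩ := exists_reflTransGen_lift hq hk hw hf (hpath.head hstep)
    exact h2.tail ⟨hg, w, fun u hu => (h3 u hu).symm⟩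

/-- `G` is `(k,q)`-mixing as soon as `k/q` exceeds twice the maximum degree. -/
theorem isCircularMixing_of_two_mul_maxDegree_lt (hq : 0 < q) (hΔ : 0 < G.maxDegree)
    (hk : 2 * q * G.maxDegree < k) : IsCircularMixing G k q := by
  obtain ⟨f, hf⟩ := exists_isHomOn hq hΔ hk Finset.univ
  have : Nonempty (G →g circularClique k q) :=
    ⟨⟨f, fun {u v} => hf u (Finset.mem_univ u) v (Finset.mem_univ v)⟩⟩
  refine ⟨fun g h => ?_⟩
  have hg : IsHomOn G (circularClique k q) Finset.univ g := fun _ _ _ _ huv => g.map_rel huv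
  have hh : IsHomOn G (circularClique k q) Finset.univ h := fun _ _ _ _ huv => h.map_rel huv
  exact reachable_of_reflTransGen hg (reflTransGen_recolourStep hq hk _ hg hh (by simp)) hh

/-! ### The threshold -/

theorem ratCast_mem_circularMixingThresholdSet (hΔ : 0 < G.maxDegree) {r : ℚ}
    (hr : 2 * (G.maxDegree : ℝ) < r) : (r : ℝ) ∈ circularMixingThresholdSet G := by
  have hmix : ∀ k q : ℕ, 0 < q → (r : ℝ) ≤ (k : ℝ) / (q : ℝ) → 2 * q * G.maxDegree < k := by
    intro k q hq hkq
    have hq' : (0 : ℝ) < q := by exact_mod_cast hq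
    have := hr.trans_le hkq
    rw [lt_div_iff₀ hq'] at this
    have h : (2 * q * G.maxDegree : ℝ) < k := by linarith
    exact_mod_cast h
  refine ⟨r, rfl, ?_, fun k q hq _ hkq =>
    isCircularMixing_of_two_mul_maxDegree_lt hq hΔ (hmix k q hq hkq)⟩
  have hr0 : (0 : ℚ) ≤ r := by
    have : (0 : ℝ) ≤ r := le_trans (by positivity) hr.le
    exact_mod_cast this
  have hrd : (r : ℝ) = (r.num.toNat : ℝ) / (r.den : ℝ) := by
    have hnum : ((r.num.toNat : ℤ) : ℝ) = (r.num : ℝ) := by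
      rw [Int.toNat_of_nonneg (Rat.num_nonneg.2 hr0)]
    rw [Rat.cast_def, ← hnum, Int.cast_natCast]
  -- Mixing at `r` itself includes a colouring, whence `χ_c(G) ≤ r`.
  have hlt := hmix r.num.toNat r.den r.pos hrd.le
  refine csInf_le ⟨0, ?_⟩ ⟨r.num.toNat, r.den, r.pos, by nlinarith,
    (isCircularMixing_of_two_mul_maxDegree_lt r.pos hΔ hlt).nonempty, hrd⟩
  rintro x ⟨k, q, -, -, -, rfl⟩
  positivity

end

theorem mainTheorem4 {V : Type*} [Fintype V] (G : SimpleGraph V) [DecidableRel G.Adj]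
    (hG : G.edgeSet.Nonempty) :
    IsGLB (circularMixingThresholdSet G) (circularMixingThreshold G) ∧
      circularMixingThreshold G ≤ 2 * (G.maxDegree : ℝ) := by
  have hΔ : 0 < G.maxDegree := by
    obtain ⟨e, he⟩ := hG
    induction e using Sym2.ind with
    | _ u v => exact ((G.degree_pos_iff_exists_adj u).2 ⟨v, he⟩).trans_le (G.degree_le_maxDegree u)
  have hbdd : BddBelow (circularMixingThresholdSet G) :=
    ⟨circularChromaticNumber G, by rintro x ⟨r, rfl, hr, -⟩; exact hr⟩
  have hmem := fun (r : ℚ) => ratCast_mem_circularMixingThresholdSet (G := G) hΔ (r := r)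
  constructor
  · obtain ⟨r, hr⟩ := exists_rat_gt (2 * (G.maxDegree : ℝ))
    exact isGLB_csInf ⟨_, hmem r hr⟩ hbdd
  · refine le_of_forall_gt_imp_ge_of_dense fun x hx => ?_
    obtain ⟨r, hr, hrx⟩ := exists_rat_btwn hx
    exact (csInf_le hbdd (hmem r hr)).trans hrx.le
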